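/- Theorem (Number of trials). For $n\ge 2$ consider the following parking process on the places $\{1,\dots,n\}$. Initially all places are empty, $x^0=(0,\dots,0)\in\{0,1\}^n$. At each trial $t=0,1,2,\dots$ a number $i$ is drawn uniformly at random in $\{1,\dots,n-1\}$, independently of the previous draws, and a car of length two tries to park on the places $i,i+1$: if $x^t_i=x^t_{i+1}=0$, then the car parks, i.e. $x^{t+1}_i=x^{t+1}_{i+1}=1$ and the other coordinates are unchanged; otherwise $x^{t+1}=x^t$. Let $T_n$ be the total number of cars that try to park, successfully or not, until the interval is jammed, i.e. the smallest $t$ such that there is no $i\in\{1,\dots,n-1\}$ with $x^t_i=x^t_{i+1}=0$. Then $T_n$ is almost surely finite for every $n\ge2$, and $$\frac{T_n}{n\log n}\longrightarrow 1\quad\text{in probability as } n\to\infty,$$ that is, $\mathbb P\left(\left|\frac{T_n}{n\log n}-1\right|\ge\varepsilon\right)\to0$ for every $\varepsilon>0$. -/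

import Mathlib

open MeasureTheory ProbabilityTheory Filter Topology

namespace PageParking

/-- A parking configuration: the places `1, …, n` are labelled by natural numbers, `x i = 1` means
that place `i` is occupied, `x i = 0` that it is empty. -/
abbrev Config : Type := ℕ → Fin 2

/-- A car can park at `i` on the interval `{1, …, n}` if `1 ≤ i ≤ n - 1` and both places `i` and
`i + 1` are empty. -/
def CanPark (n : ℕ) (x : Config) (i : ℕ) : Prop :=
  1 ≤ i ∧ i + 1 ≤ n ∧ x i = 0 ∧ x (i + 1) = 0

instance (n : ℕ) (x : Config) (i : ℕ) : Decidable (CanPark n x i) :=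
  inferInstanceAs (Decidable (_ ∧ _ ∧ _ ∧ _))

/-- One trial: a car tries to park at `i`; if it cannot, the configuration does not change. -/
def tryPark (n : ℕ) (x : Config) (i : ℕ) : Config :=
  if CanPark n x i then Function.update (Function.update x i 1) (i + 1) 1 else x

/-- The configuration `x^t` after `t` trials, when the successive cars try to park at
`u 0, u 1, u 2, …`. -/
def config (n : ℕ) (u : ℕ → ℕ) : ℕ → Config
  | 0 => fun _ => 0
  | t + 1 => tryPark n (config n u t) (u t)

/-- The interval `{1, …, n}` is jammed: no two adjacent places are both empty. -/
def IsJammed (n : ℕ) (x : Config) : Prop :=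
  ∀ i, 1 ≤ i → i + 1 ≤ n → ¬(x i = 0 ∧ x (i + 1) = 0)

/-- The number `T_n` of trials (successful or not) until the interval is jammed, i.e. the first `t`
such that `x^t` is jammed; it is `⊤` if this never happens. -/
noncomputable def numTrials (n : ℕ) (u : ℕ → ℕ) : ℕ∞ :=
  ⨅ (t : ℕ) (_ : IsJammed n (config n u t)), (t : ℕ∞)

/-- The random variables `U 0, U 1, …` are independent and uniform on `{1, …, n - 1}`. -/
structure IsUniformDraws {Ω : Type*} [MeasurableSpace Ω] (μ : Measure Ω) (n : ℕ)
    (U : ℕ → Ω → ℕ) : Prop where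
  measurable : ∀ t, Measurable (U t)
  map_eq : ∀ t, μ.map (U t) = uniformOn (Set.Icc 1 (n - 1))
  indep : iIndepFun U μ

end PageParking

/-! ### Deterministic dynamics: when the interval is jammed, and when it cannot be. -/

namespace PageParking

/-! Write `N = n - 1` for the number of possible draws. The upper bound is coupon collecting: once
every value has been drawn the interval is jammed, and some value is missing at time `t` with
probability at most `N (1 - 1/N) ^ t`, which is small for `t` near `(1 + δ/2) n log n`.

For the lower bound, cars parked early at `c + 2` and `c + 6` enclose the empty pair `c + 4`, `c +
5`, which only the draw `c + 4` can then fill. Fixing the times `a, b < N` of these two draws makes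
this a product event (`freezingEvent`) of probability at least a constant times `N⁻² (1 - 1/N) ^ t`.
There are of order `N ^ 3` triples `(c, a, b)` with disjoint windows, so the expected number of such
events is at least of order `N exp (-t / (N - 1))`, which diverges for `t` near `(1 - δ) n log n`.
Events on the same window exclude each other; on disjoint windows they are negatively correlated up
to a factor `(1 - 7/N)⁻¹ ^ 4 → 1` (`freezingDraws_inter_le`). The second moment method
`measureReal_forall_notMem_le` then produces an unfilled pair with high probability. -/

theorem tryPark_apply_eq_one {n i k : ℕ} {x : Config} (h : x k = 1) : tryPark n x i k = 1 := by
  unfold tryPark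
  split_ifs
  · simp only [Function.update_apply]
    split_ifs <;> simp [h]
  · exact h

theorem tryPark_apply_of_ne {n i k : ℕ} {x : Config} (h : k ≠ i) (h' : k ≠ i + 1) :
    tryPark n x i k = x k := by
  unfold tryPark
  split_ifs <;> simp [h, h']

theorem tryPark_of_not_canPark {n i : ℕ} {x : Config} (h : ¬CanPark n x i) :
    tryPark n x i = x := if_neg h

theorem tryPark_of_canPark {n i : ℕ} {x : Config} (h : CanPark n x i) :
    tryPark n x i i = 1 ∧ tryPark n x i (i + 1) = 1 := by
  simp [tryPark, h]

theorem config_eq_one_mono {n k s t : ℕ} {u : ℕ → ℕ} (hst : s ≤ t) (h : config n u s k = 1) :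
    config n u t k = 1 := by
  induction t, hst using Nat.le_induction with
  | base => exact h
  | succ t _ ih => exact tryPark_apply_eq_one ih

/-- Places never become free again, so a pair empty at time `t` was empty when its left place was
drawn, and that car would have parked. -/
theorem isJammed_config_of_forall_drawn {n t : ℕ} {u : ℕ → ℕ}
    (h : ∀ i ∈ Set.Icc 1 (n - 1), ∃ r < t, u r = i) : IsJammed n (config n u t) := by
  rintro i hi hin ⟨h0, h1⟩
  obtain ⟨r, hr, rfl⟩ := h i ⟨hi, by omega⟩
  have zero_of {k : ℕ} (hk : config n u t k = 0) : ∀ s ≤ t, config n u s k = 0 := by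
    intro s hs
    by_contra hne
    have := config_eq_one_mono hs (Fin.eq_one_of_ne_zero _ hne)
    simp [hk] at this
  have hpark : CanPark n (config n u r) (u r) :=
    ⟨hi, hin, zero_of h0 r hr.le, zero_of h1 r hr.le⟩
  have h2 : config n u (r + 1) (u r) = 1 := (tryPark_of_canPark hpark).1
  have h3 := zero_of h0 (r + 1) hr
  simp [h2] at h3

/-- The draws which freeze the two adjacent places `c + 4`, `c + 5` empty during the trials before
time `t`: before time `s`, the only draws in the window `{c + 1, …, c + 7}` are `c + 2` at time `a`
and `c + 6` at time `b`; from time `s` on, `c + 4` is not drawn. -/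
def freezingDraws (c a b s r : ℕ) : Set ℕ :=
  if r < s then
    if r = a then {c + 2} else if r = b then {c + 6} else (Set.Icc (c + 1) (c + 7))ᶜ
  else {c + 4}ᶜ

theorem config_eq_zero_of_freezingDraws {n c a b s t : ℕ} {u : ℕ → ℕ} (hab : a ≠ b)
    (ha : a < s) (hb : b < s) (hn : c + 7 < n)
    (hu : ∀ r < t, u r ∈ freezingDraws c a b s r) :
    ∀ r ≤ t, config n u r (c + 4) = 0 ∧ config n u r (c + 5) = 0 := by
  -- The invariant also follows the two guards: their places stay empty until the draws at `a` and
  -- `b`, after which `c + 3` and `c + 6` are occupied.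
  suffices H : ∀ r ≤ t, (config n u r (c + 4) = 0 ∧ config n u r (c + 5) = 0) ∧
      (r ≤ a → config n u r (c + 2) = 0 ∧ config n u r (c + 3) = 0) ∧
      (a < r → config n u r (c + 3) = 1) ∧
      (r ≤ b → config n u r (c + 6) = 0 ∧ config n u r (c + 7) = 0) ∧
      (b < r → config n u r (c + 6) = 1) from fun r hr => (H r hr).1
  intro r
  induction r with
  | zero => simp [config]
  | succ r ih =>
    intro hr
    obtain ⟨⟨h4, h5⟩, hl0, hl1, hr0, hr1⟩ := ih (by omega)
    have hur := hu r (by omega)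
    simp only [config]
    by_cases hrs : r < s
    · by_cases hra : r = a
      · have hua : u r = c + 2 := by simpa [freezingDraws, hrs, hra, ha] using hur
        rw [hua]
        have hp : CanPark n (config n u r) (c + 2) :=
          ⟨by omega, by omega, (hl0 hra.le).1, (hl0 hra.le).2⟩
        have h2 := tryPark_of_canPark hp
        refine ⟨?_, fun h => by omega, fun _ => h2.2, fun h => ?_, fun h => ?_⟩
        · rw [tryPark_apply_of_ne (by omega) (by omega), tryPark_apply_of_ne (by omega) (by omega)]
          exact ⟨h4, h5⟩
        · rw [tryPark_apply_of_ne (by omega) (by omega), tryPark_apply_of_ne (by omega) (by omega)]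
          exact hr0 (by omega)
        · exact tryPark_apply_eq_one (hr1 (by omega))
      · by_cases hrb : r = b
        · have hub : u r = c + 6 := by
            simpa [freezingDraws, hrs, hrb, hb, hab.symm] using hur
          rw [hub]
          have hp : CanPark n (config n u r) (c + 6) :=
            ⟨by omega, by omega, (hr0 hrb.le).1, (hr0 hrb.le).2⟩
          have h2 := tryPark_of_canPark hp
          refine ⟨?_, fun h => ?_, fun h => ?_, fun h => by omega, fun _ => h2.1⟩
          · rw [tryPark_apply_of_ne (by omega) (by omega),
              tryPark_apply_of_ne (by omega) (by omega)]
            exact ⟨h4, h5⟩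
          · rw [tryPark_apply_of_ne (by omega) (by omega),
              tryPark_apply_of_ne (by omega) (by omega)]
            exact hl0 (by omega)
          · exact tryPark_apply_eq_one (hl1 (by omega))
        · have hW : ¬(c + 1 ≤ u r ∧ u r ≤ c + 7) := by
            simp only [freezingDraws, hrs, hra, hrb, if_true, if_false] at hur
            exact hur
          have hk (k : ℕ) (h : c + 2 ≤ k) (h' : k ≤ c + 7) :
              tryPark n (config n u r) (u r) k = config n u r k :=
            tryPark_apply_of_ne (by omega) (by omega)
          rw [hk (c + 2) (by omega) (by omega), hk (c + 3) (by omega) (by omega),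
            hk (c + 4) (by omega) (by omega), hk (c + 5) (by omega) (by omega),
            hk (c + 6) (by omega) (by omega), hk (c + 7) (by omega) (by omega)]
          exact ⟨⟨h4, h5⟩, fun h => hl0 (by omega), fun h => hl1 (by omega),
            fun h => hr0 (by omega), fun h => hr1 (by omega)⟩
    · have h3 := hl1 (by omega)
      have h6 := hr1 (by omega)
      have hne : u r ≠ c + 4 := by simpa [freezingDraws, hrs] using hur
      refine ⟨?_, fun h => by omega, fun _ => tryPark_apply_eq_one h3, fun h => by omega,
        fun _ => tryPark_apply_eq_one h6⟩
      -- With both guards in place, the draws `c + 3` and `c + 5` fail, so only the excluded `c + 4`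
      -- could touch the pair.
      by_cases hp : CanPark n (config n u r) (u r)
      · obtain ⟨-, -, hp1, hp2⟩ := hp
        have n3 : u r ≠ c + 3 := by rintro h; simp [h, h3] at hp1
        have n5 : u r ≠ c + 5 := by rintro h; simp [h, h6] at hp2
        rw [tryPark_apply_of_ne (by omega) (by omega), tryPark_apply_of_ne (by omega) (by omega)]
        exact ⟨h4, h5⟩
      · rw [tryPark_of_not_canPark hp]
        exact ⟨h4, h5⟩

theorem numTrials_le {n t : ℕ} {u : ℕ → ℕ} (h : IsJammed n (config n u t)) :
    numTrials n u ≤ t := iInf₂_le t h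

theorem lt_numTrials {n t : ℕ} {u : ℕ → ℕ} (h : ∀ r ≤ t, ¬IsJammed n (config n u r)) :
    (t : ℕ∞) < numTrials n u := by
  have : ((t + 1 : ℕ) : ℕ∞) ≤ numTrials n u := by
    refine le_iInf₂ fun r hr => ?_
    have : t < r := by
      by_contra hlt
      exact h r (by omega) hr
    exact_mod_cast this
  exact lt_of_lt_of_le (by exact_mod_cast Nat.lt_succ_self t) this

end PageParking

/-! ### Second moment method. -/

/-- The second moment method: if the events `E i` are pairwise almost negatively correlated, then
with high probability at least one of them occurs. -/
theorem measureReal_forall_notMem_le {Ω ι : Type*} [MeasurableSpace Ω] {μ : Measure Ω}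
    [IsProbabilityMeasure μ] (J : Finset ι) {E : ι → Set Ω} (hE : ∀ i ∈ J, MeasurableSet (E i))
    {C : ℝ} (hC : 0 ≤ C)
    (h : ∀ i ∈ J, ∀ j ∈ J, i ≠ j → μ.real (E i ∩ E j) ≤ C * (μ.real (E i) * μ.real (E j)))
    (hpos : 0 < ∑ i ∈ J, μ.real (E i)) :
    μ.real {ω | ∀ i ∈ J, ω ∉ E i} ≤ (∑ i ∈ J, μ.real (E i))⁻¹ + (C - 1) := by
  classical
  set m := ∑ i ∈ J, μ.real (E i) with hm
  have hset : MeasurableSet {ω | ∀ i ∈ J, ω ∉ E i} := by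
    have : {ω | ∀ i ∈ J, ω ∉ E i} = ⋂ i ∈ J, (E i)ᶜ := by ext; simp
    rw [this]
    exact Finset.measurableSet_biInter _ fun i hi => (hE i hi).compl
  have hint {A : Set Ω} (hA : MeasurableSet A) : Integrable (A.indicator (1 : Ω → ℝ)) μ :=
    (integrable_const (1 : ℝ)).indicator hA
  have hsq (ω : Ω) : (∑ i ∈ J, (E i).indicator (1 : Ω → ℝ) ω - m) ^ 2 =
      (∑ i ∈ J, ∑ j ∈ J, (E i ∩ E j).indicator (1 : Ω → ℝ) ω)
        - 2 * m * (∑ i ∈ J, (E i).indicator (1 : Ω → ℝ) ω) + m ^ 2 := by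
    have : ∑ i ∈ J, ∑ j ∈ J, (E i ∩ E j).indicator (1 : Ω → ℝ) ω =
        (∑ i ∈ J, (E i).indicator (1 : Ω → ℝ) ω) ^ 2 := by
      rw [sq, Finset.sum_mul_sum]
      simp only [Set.inter_indicator_one, Pi.mul_apply]
    rw [this]; ring
  have hi1 : Integrable (fun ω => ∑ i ∈ J, ∑ j ∈ J, (E i ∩ E j).indicator (1 : Ω → ℝ) ω) μ :=
    integrable_finsetSum _ fun i hi => integrable_finsetSum _ fun j hj =>
      hint ((hE i hi).inter (hE j hj))
  have hi2 : Integrable (fun ω => 2 * m * ∑ i ∈ J, (E i).indicator (1 : Ω → ℝ) ω) μ :=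
    (integrable_finsetSum _ fun i hi => hint (hE i hi)).const_mul _
  have e1 : ∫ ω, ∑ i ∈ J, ∑ j ∈ J, (E i ∩ E j).indicator (1 : Ω → ℝ) ω ∂μ =
      ∑ i ∈ J, ∑ j ∈ J, μ.real (E i ∩ E j) := by
    rw [integral_finsetSum _ fun i hi => integrable_finsetSum _ fun j hj =>
      hint ((hE i hi).inter (hE j hj))]
    refine Finset.sum_congr rfl fun i hi => ?_
    rw [integral_finsetSum _ fun j hj => hint ((hE i hi).inter (hE j hj))]
    exact Finset.sum_congr rfl fun j hj => integral_indicator_one ((hE i hi).inter (hE j hj))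
  have e2 : ∫ ω, ∑ i ∈ J, (E i).indicator (1 : Ω → ℝ) ω ∂μ = m := by
    rw [integral_finsetSum _ fun i hi => hint (hE i hi)]
    exact Finset.sum_congr rfl fun i hi => integral_indicator_one (hE i hi)
  have hvar : ∫ ω, (∑ i ∈ J, (E i).indicator (1 : Ω → ℝ) ω - m) ^ 2 ∂μ =
      (∑ i ∈ J, ∑ j ∈ J, μ.real (E i ∩ E j)) - m ^ 2 := by
    simp only [hsq]
    have h1 := integral_add (hi1.sub hi2) (integrable_const (m ^ 2))
    have h2 := integral_sub hi1 hi2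
    simp only [Pi.sub_apply] at h1
    rw [h1, h2, e1, integral_const_mul, e2, integral_const, probReal_univ, one_smul]
    ring
  -- The diagonal contributes exactly `m`; hence the variance is at most `m + (C - 1) m ^ 2`.
  have hdouble : ∑ i ∈ J, ∑ j ∈ J, μ.real (E i ∩ E j) ≤ m + C * m ^ 2 := by
    have : m + C * m ^ 2 = ∑ i ∈ J, ∑ j ∈ J,
        ((if i = j then μ.real (E i) else 0) + C * (μ.real (E i) * μ.real (E j))) := by
      simp only [Finset.sum_add_distrib, ← Finset.mul_sum, ← Finset.sum_mul, ← hm]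
      congr 1
      · refine Finset.sum_congr rfl fun i hi => ?_
        rw [Finset.sum_ite_eq, if_pos hi]
      · ring
    rw [this]
    refine Finset.sum_le_sum fun i hi => Finset.sum_le_sum fun j hj => ?_
    by_cases hij : i = j
    · subst hij
      rw [if_pos rfl, Set.inter_self]
      have : 0 ≤ C * (μ.real (E i) * μ.real (E i)) := by positivity
      linarith
    · rw [if_neg hij, zero_add]
      exact h i hi j hj hij
  -- Chebyshev: where no event occurs, the squared deviation equals `m ^ 2`.
  have hle : m ^ 2 * μ.real {ω | ∀ i ∈ J, ω ∉ E i} ≤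
      ∫ ω, (∑ i ∈ J, (E i).indicator (1 : Ω → ℝ) ω - m) ^ 2 ∂μ := by
    rw [← integral_indicator_one hset, ← integral_const_mul]
    refine integral_mono ((hint hset).const_mul _) ?_ fun ω => ?_
    · simp only [hsq]
      exact (hi1.sub hi2).add (integrable_const _)
    · by_cases hω : ω ∈ {ω | ∀ i ∈ J, ω ∉ E i}
      · have : ∑ i ∈ J, (E i).indicator (1 : Ω → ℝ) ω = 0 :=
          Finset.sum_eq_zero fun i hi => Set.indicator_of_notMem (hω i hi) _
        simp [this, Set.indicator_of_mem hω]
      · simp only [Set.indicator_of_notMem hω, mul_zero]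
        positivity
  rw [hvar] at hle
  have h2 : m ^ 2 * μ.real {ω | ∀ i ∈ J, ω ∉ E i} ≤ m ^ 2 * (m⁻¹ + (C - 1)) := by
    have : m ^ 2 * (m⁻¹ + (C - 1)) = m + C * m ^ 2 - m ^ 2 := by field_simp; ring
    linarith
  exact le_of_mul_le_mul_left h2 (by positivity)

/-! ### Uniform draws: product formula, coupon collector bound, one-step correlations. -/

namespace PageParking

theorem isProbabilityMeasure_uniformOn_Icc {N : ℕ} (hN : 0 < N) :
    IsProbabilityMeasure (uniformOn (Set.Icc 1 N)) :=
  isProbabilityMeasure_uniformOn (Set.finite_Icc _ _) ⟨1, le_rfl, hN⟩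

theorem uniformOn_Icc_real_of_subset {N : ℕ} {A : Finset ℕ} (hA : (A : Set ℕ) ⊆ Set.Icc 1 N) :
    (uniformOn (Set.Icc 1 N)).real A = A.card / N := by
  have hs : (Set.Icc 1 N).Finite := Set.finite_Icc _ _
  rw [Measure.real, uniformOn, cond_apply hs.measurableSet, Set.inter_eq_right.mpr hA,
    Measure.count_apply_finset, ← Finset.coe_Icc, Measure.count_apply_finset]
  simp [div_eq_inv_mul]

section

variable {Ω : Type*} [MeasurableSpace Ω] {μ : Measure Ω} {N : ℕ} {U : ℕ → Ω → ℕ}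

theorem IsUniformDraws.measurableSet_forall (hU : IsUniformDraws μ (N + 1) U) (t : ℕ)
    (S : ℕ → Set ℕ) : MeasurableSet {ω | ∀ r < t, U r ω ∈ S r} := by
  have : {ω | ∀ r < t, U r ω ∈ S r} = ⋂ r ∈ Finset.range t, U r ⁻¹' S r := by ext; simp
  rw [this]
  exact Finset.measurableSet_biInter _ fun r _ => hU.measurable r (.of_discrete)

theorem IsUniformDraws.measureReal_forall (hU : IsUniformDraws μ (N + 1) U) (t : ℕ)
    (S : ℕ → Set ℕ) :
    μ.real {ω | ∀ r < t, U r ω ∈ S r} =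
      ∏ r ∈ Finset.range t, (uniformOn (Set.Icc 1 N)).real (S r) := by
  have : {ω | ∀ r < t, U r ω ∈ S r} = ⋂ r ∈ Finset.range t, U r ⁻¹' S r := by ext; simp
  rw [this, Measure.real, hU.indep.measure_inter_preimage_eq_mul (Finset.range t) (sets := S)
    fun _ _ => .of_discrete, ENNReal.toReal_prod]
  refine Finset.prod_congr rfl fun r _ => ?_
  have h := hU.map_eq r
  rw [Nat.add_sub_cancel] at h
  rw [← h, Measure.real, Measure.map_apply (hU.measurable r) .of_discrete]

theorem IsUniformDraws.measureReal_exists_not_drawn_le (hU : IsUniformDraws μ (N + 1) U)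
    (hN : 0 < N) (t : ℕ) :
    μ.real {ω | ∃ i ∈ Set.Icc 1 N, ∀ r < t, U r ω ≠ i} ≤ N * (1 - 1 / N : ℝ) ^ t := by
  have := isProbabilityMeasure_uniformOn_Icc hN
  have hset : {ω | ∃ i ∈ Set.Icc 1 N, ∀ r < t, U r ω ≠ i} =
      ⋃ i ∈ Finset.Icc 1 N, {ω | ∀ r < t, U r ω ∈ ({i} : Set ℕ)ᶜ} := by ext; simp
  rw [hset]
  refine (measureReal_biUnion_finset_le _ _).trans ?_
  have : ∀ i ∈ Finset.Icc 1 N, μ.real {ω | ∀ r < t, U r ω ∈ ({i} : Set ℕ)ᶜ} =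
      (1 - 1 / N : ℝ) ^ t := by
    intro i hi
    have h1 := uniformOn_Icc_real_of_subset (N := N) (A := {i}) (by simpa using hi)
    rw [hU.measureReal_forall, Finset.prod_const, Finset.card_range,
      probReal_compl_eq_one_sub .of_discrete]
    simp only [Finset.coe_singleton, Finset.card_singleton, Nat.cast_one] at h1
    rw [h1]
  rw [Finset.sum_congr rfl this]
  simp

theorem uniformOn_Icc_real_window {c : ℕ} (hc : c + 7 ≤ N) :
    (uniformOn (Set.Icc 1 N)).real (Set.Icc (c + 1) (c + 7)) = 7 / N := by
  have h := uniformOn_Icc_real_of_subset (N := N) (A := Finset.Icc (c + 1) (c + 7))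
    (by rw [Finset.coe_Icc]; exact Set.Icc_subset_Icc (by omega) (by omega))
  rw [Finset.coe_Icc] at h
  simpa using h

theorem uniformOn_Icc_real_singleton {i : ℕ} (hi : i ∈ Set.Icc 1 N) :
    (uniformOn (Set.Icc 1 N)).real {i} = 1 / N := by
  simpa using uniformOn_Icc_real_of_subset (N := N) (A := {i}) (by simpa using hi)

theorem measureReal_compl_inter_compl_le {α : Type*} [MeasurableSpace α] (ν : Measure α)
    [IsProbabilityMeasure ν] {A B : Set α} (hA : MeasurableSet A) (hB : MeasurableSet B)
    (h : Disjoint A B) : ν.real (Aᶜ ∩ Bᶜ) ≤ ν.real Aᶜ * ν.real Bᶜ := by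
  rw [← Set.compl_union, probReal_compl_eq_one_sub (hA.union hB), probReal_compl_eq_one_sub hA,
    probReal_compl_eq_one_sub hB, measureReal_union h hB]
  nlinarith [measureReal_nonneg (μ := ν) (s := A), measureReal_nonneg (μ := ν) (s := B)]

/-- The event that the draws freeze the places `c + 4`, `c + 5` up to time `t`. -/
def freezingEvent (U : ℕ → Ω → ℕ) (s t c a b : ℕ) : Set Ω :=
  {ω | ∀ r < t, U r ω ∈ freezingDraws c a b s r}

/-- Complements of disjoint sets are negatively correlated, and distinct singletons are disjoint. A
loss arises only when one event prescribes its draw and the other avoids its window: dropping the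
avoidance costs `(1 - 7/N)⁻¹`. This can happen only at the times `a`, `b`, `a'`, `b'`, so the
product over all times loses at most four such factors. -/
theorem freezingDraws_inter_le {N c c' a b a' b' s r : ℕ} (hN : 7 < N) (hc : c + 7 ≤ N)
    (hc' : c' + 7 ≤ N) (h : c + 7 ≤ c' ∨ c' + 7 ≤ c) :
    (uniformOn (Set.Icc 1 N)).real (freezingDraws c a b s r ∩ freezingDraws c' a' b' s r) ≤
      ((if r = a then (1 - 7 / N : ℝ)⁻¹ else 1) * (if r = b then (1 - 7 / N : ℝ)⁻¹ else 1) *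
        ((if r = a' then (1 - 7 / N : ℝ)⁻¹ else 1) * (if r = b' then (1 - 7 / N : ℝ)⁻¹ else 1))) *
      ((uniformOn (Set.Icc 1 N)).real (freezingDraws c a b s r) *
        (uniformOn (Set.Icc 1 N)).real (freezingDraws c' a' b' s r)) := by
  have := isProbabilityMeasure_uniformOn_Icc (N := N) (by omega)
  set ν := uniformOn (Set.Icc 1 N)
  have hN' : (7 : ℝ) < N := by exact_mod_cast hN
  have hq : 0 < (1 - 7 / N : ℝ) := by
    rw [sub_pos, div_lt_one (by positivity)]; exact hN'
  have hq1 : 1 ≤ (1 - 7 / N : ℝ)⁻¹ :=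
    (one_le_inv₀ hq).mpr (by have : 0 ≤ (7 / N : ℝ) := by positivity
                             linarith)
  set κ := (1 - 7 / N : ℝ)⁻¹ with hκ
  have hone (p : Prop) [Decidable p] : 1 ≤ (if p then κ else 1) := by split_ifs <;> simp [hq1]
  have hW (d : ℕ) (hd : d + 7 ≤ N) : κ * ν.real (Set.Icc (d + 1) (d + 7))ᶜ = 1 := by
    rw [probReal_compl_eq_one_sub .of_discrete, uniformOn_Icc_real_window hd, hκ,
      inv_mul_cancel₀ hq.ne']
  set F := ((if r = a then κ else 1) * (if r = b then κ else 1) *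
        ((if r = a' then κ else 1) * (if r = b' then κ else 1))) with hF
  have hF1 : 1 ≤ (if r = a then κ else 1) * (if r = b then κ else 1) :=
    one_le_mul_of_one_le_of_one_le (hone _) (hone _)
  have hF2 : 1 ≤ (if r = a' then κ else 1) * (if r = b' then κ else 1) :=
    one_le_mul_of_one_le_of_one_le (hone _) (hone _)
  have hFone : 1 ≤ F := one_le_mul_of_one_le_of_one_le hF1 hF2
  have hFκ (hr : (r = a ∨ r = b) ∨ (r = a' ∨ r = b')) : κ ≤ F := by
    have key (p q : Prop) [Decidable p] [Decidable q] (hpq : p ∨ q) :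
        κ ≤ (if p then κ else 1) * (if q then κ else 1) := by
      rcases hpq with hp | hp
      · rw [if_pos hp]; exact le_mul_of_one_le_right (by linarith) (hone _)
      · rw [if_pos hp]; exact le_mul_of_one_le_left (by linarith) (hone _)
    rcases hr with hr | hr
    · exact (key _ _ hr).trans (le_mul_of_one_le_right (by linarith) hF2)
    · exact (key _ _ hr).trans (le_mul_of_one_le_left (by linarith) hF1)
  have hsub {A B : Set ℕ} (hFB : 1 ≤ F * ν.real B) : ν.real (A ∩ B) ≤ F * (ν.real A * ν.real B) :=
    calc ν.real (A ∩ B) ≤ ν.real A := measureReal_mono Set.inter_subset_left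
      _ ≤ ν.real A * (F * ν.real B) := le_mul_of_one_le_right measureReal_nonneg hFB
      _ = _ := by ring
  have hsub' {A B : Set ℕ} (hFA : 1 ≤ F * ν.real A) :
      ν.real (A ∩ B) ≤ F * (ν.real A * ν.real B) := by
    rw [Set.inter_comm, mul_comm (ν.real A)]; exact hsub hFA
  have hcompl {A B : Set ℕ} (hAB : Disjoint A B) :
      ν.real (Aᶜ ∩ Bᶜ) ≤ F * (ν.real Aᶜ * ν.real Bᶜ) :=
    (measureReal_compl_inter_compl_le ν .of_discrete .of_discrete hAB).trans
      (le_mul_of_one_le_left (mul_nonneg measureReal_nonneg measureReal_nonneg) hFone)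
  have hsingle {i j : ℕ} (hij : i ≠ j) :
      ν.real (({i} : Set ℕ) ∩ {j}) ≤ F * (ν.real {i} * ν.real {j}) := by
    have : ({i} : Set ℕ) ∩ {j} = ∅ := by simpa using hij.symm
    rw [this, measureReal_empty]
    have := zero_le_one.trans hFone
    positivity
  have hFW (d : ℕ) (hd : d + 7 ≤ N) (hr : (r = a ∨ r = b) ∨ (r = a' ∨ r = b')) :
      1 ≤ F * ν.real (Set.Icc (d + 1) (d + 7))ᶜ := by
    rw [← hW d hd]
    exact mul_le_mul_of_nonneg_right (hFκ hr) measureReal_nonneg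
  have hdisj : Disjoint (Set.Icc (c + 1) (c + 7)) (Set.Icc (c' + 1) (c' + 7)) := by
    rw [Set.disjoint_left]
    rintro x ⟨h1, h2⟩ ⟨h3, h4⟩
    omega
  unfold freezingDraws
  by_cases hrs : r < s
  · simp only [hrs, if_true]
    split_ifs <;>
      first
        | exact hsingle (by omega)
        | exact hcompl hdisj
        | exact hsub (hFW _ hc' (by tauto))
        | exact hsub' (hFW _ hc (by tauto))
  · simp only [hrs, if_false]
    exact hcompl (by rw [Set.disjoint_singleton]; omega)

end
-- Probabilities of freezing events and the lower tail.
section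

variable {Ω : Type*} [MeasurableSpace Ω] {μ : Measure Ω}
  {N : ℕ} {U : ℕ → Ω → ℕ}

theorem prod_range_ite_eq {t a : ℕ} (ha : a < t) (x : ℝ) :
    ∏ r ∈ Finset.range t, (if r = a then x else 1) = x := by
  rw [Finset.prod_ite_eq', if_pos (Finset.mem_range.mpr ha)]

theorem prod_range_ite_lt {s t : ℕ} (hst : s ≤ t) (x : ℝ) :
    ∏ r ∈ Finset.range t, (if r < s then x else 1) = x ^ s := by
  rw [← Finset.prod_filter]
  have : (Finset.range t).filter (· < s) = Finset.range s := by ext; simp; omega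
  rw [this, Finset.prod_const, Finset.card_range]

theorem IsUniformDraws.measureReal_freezingEvent_inter_le (hU : IsUniformDraws μ (N + 1) U)
    (hN : 7 < N) {s t c c' a b a' b' : ℕ} (hst : s ≤ t) (hc : c + 7 ≤ N) (hc' : c' + 7 ≤ N)
    (h : c + 7 ≤ c' ∨ c' + 7 ≤ c) (ha : a < s) (hb : b < s) (ha' : a' < s) (hb' : b' < s) :
    μ.real (freezingEvent U s t c a b ∩ freezingEvent U s t c' a' b') ≤
      (1 - 7 / N : ℝ)⁻¹ ^ 4 *
        (μ.real (freezingEvent U s t c a b) * μ.real (freezingEvent U s t c' a' b')) := by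
  have hinter : freezingEvent U s t c a b ∩ freezingEvent U s t c' a' b' =
      {ω | ∀ r < t, U r ω ∈ freezingDraws c a b s r ∩ freezingDraws c' a' b' s r} := by
    ext ω
    exact ⟨fun hω r hr => ⟨hω.1 r hr, hω.2 r hr⟩, fun hω =>
      ⟨fun r hr => (hω r hr).1, fun r hr => (hω r hr).2⟩⟩
  rw [hinter, hU.measureReal_forall, freezingEvent, freezingEvent, hU.measureReal_forall,
    hU.measureReal_forall, ← Finset.prod_mul_distrib]
  refine (Finset.prod_le_prod (fun _ _ => measureReal_nonneg)
    fun r _ => freezingDraws_inter_le (s := s) (r := r) (a := a) (b := b) (a' := a') (b' := b')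
      hN hc hc' h).trans_eq ?_
  rw [Finset.prod_mul_distrib, Finset.prod_mul_distrib, Finset.prod_mul_distrib,
    Finset.prod_mul_distrib, prod_range_ite_eq (by omega), prod_range_ite_eq (by omega),
    prod_range_ite_eq (by omega), prod_range_ite_eq (by omega)]
  congr 1
  ring

omit [MeasurableSpace Ω] in
-- Before time `s`, the draw `c + 2` occurs only at the first marked time and `c + 6` only at the
-- second, so the draws determine both times.
theorem disjoint_freezingEvent {s t c a b a' b' : ℕ} (hst : s ≤ t) (ha : a < s) (hb : b < s)
    (hab : a ≠ b) (h : (a, b) ≠ (a', b')) :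
    freezingEvent U s t c a b ∩ freezingEvent U s t c a' b' = ∅ := by
  rw [Set.eq_empty_iff_forall_notMem]
  rintro ω ⟨h1, h2⟩
  have a1 := h1 a (by omega)
  have a2 := h2 a (by omega)
  have b1 := h1 b (by omega)
  have b2 := h2 b (by omega)
  simp only [freezingDraws, ha, hb, hab.symm, if_true, if_false,
    Set.mem_singleton_iff] at a1 a2 b1 b2
  rw [a1] at a2
  rw [b1] at b2
  have ha' : a = a' := by
    by_contra hne
    rw [if_neg hne] at a2
    split_ifs at a2
    · simp at a2
    · simp at a2
  have hb' : b = b' := by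
    by_contra hne
    rw [if_neg hne] at b2
    split_ifs at b2
    · simp at b2
    · simp at b2
  exact h (by rw [ha', hb'])

theorem IsUniformDraws.le_measureReal_freezingEvent (hU : IsUniformDraws μ (N + 1) U)
    (hN : 7 < N) {s t c a b : ℕ} (hst : s ≤ t) (hc : c + 7 ≤ N) (ha : a < s) (hb : b < s) :
    (1 / N : ℝ) * (1 / N) * (1 - 7 / N) ^ s * (1 - 1 / N) ^ t ≤
      μ.real (freezingEvent U s t c a b) := by
  have := isProbabilityMeasure_uniformOn_Icc (N := N) (by omega)
  have hN' : (7 : ℝ) < N := by exact_mod_cast hN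
  have hq : 0 ≤ (1 - 7 / N : ℝ) := by
    rw [sub_nonneg, div_le_one (by positivity)]; exact hN'.le
  have hq' : (1 - 7 / N : ℝ) ≤ 1 := sub_le_self _ (by positivity)
  have hp : 0 ≤ (1 - 1 / N : ℝ) := by
    rw [sub_nonneg, div_le_one (by positivity)]; linarith
  have hp' : (1 - 1 / N : ℝ) ≤ 1 := sub_le_self _ (by positivity)
  have hi : 0 ≤ (1 / N : ℝ) := by positivity
  have hi' : (1 / N : ℝ) ≤ 1 := by rw [div_le_one (by positivity)]; linarith
  -- Charging superfluous factors at most `1` to every time, including `a`, `b` and those before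
  -- `s`, gives a closed form; for `s = N` this loses only a constant.
  have hprod : (1 / N : ℝ) * (1 / N) * (1 - 7 / N) ^ s * (1 - 1 / N) ^ t =
      ∏ r ∈ Finset.range t, ((if r = a then (1 / N : ℝ) else 1) * (if r = b then (1 / N : ℝ) else 1)
        * (if r < s then (1 - 7 / N : ℝ) else 1) * (1 - 1 / N : ℝ)) := by
    rw [Finset.prod_mul_distrib, Finset.prod_mul_distrib, Finset.prod_mul_distrib,
      prod_range_ite_eq (by omega), prod_range_ite_eq (by omega), prod_range_ite_lt hst,
      Finset.prod_const, Finset.card_range]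
  rw [hprod, freezingEvent, hU.measureReal_forall]
  have hite {p : Prop} [Decidable p] {x : ℝ} (hx : 0 ≤ x) (hx' : x ≤ 1) :
      0 ≤ (if p then x else 1) ∧ (if p then x else 1) ≤ 1 := by
    split_ifs <;> simp [hx, hx']
  have hcompl (i : ℕ) (hi : i ∈ Set.Icc 1 N) :
      (uniformOn (Set.Icc 1 N)).real ({i}ᶜ) = 1 - 1 / N := by
    rw [probReal_compl_eq_one_sub .of_discrete, uniformOn_Icc_real_singleton hi]
  refine Finset.prod_le_prod (fun r _ => ?_) fun r _ => ?_
  · have h1 := (hite (p := r = a) hi hi').1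
    have h2 := (hite (p := r = b) hi hi').1
    have h3 := (hite (p := r < s) hq hq').1
    positivity
  · unfold freezingDraws
    have h2' := (hite (p := r = b) hi hi').2
    by_cases hrs : r < s
    · simp only [hrs, if_true]
      by_cases hra : r = a
      · simp only [if_pos hra]
        rw [uniformOn_Icc_real_singleton ⟨by omega, by omega⟩, mul_assoc, mul_assoc]
        exact mul_le_of_le_one_right hi (mul_le_one₀ h2' (by positivity) (mul_le_one₀ hq' hp hp'))
      · simp only [if_neg hra, one_mul]
        by_cases hrb : r = b
        · simp only [if_pos hrb]
          rw [uniformOn_Icc_real_singleton ⟨by omega, by omega⟩, mul_assoc]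
          exact mul_le_of_le_one_right hi (mul_le_one₀ hq' hp hp')
        · simp only [if_neg hrb, one_mul]
          rw [probReal_compl_eq_one_sub .of_discrete, uniformOn_Icc_real_window hc]
          exact mul_le_of_le_one_right hq hp'
    · have hra : r ≠ a := by omega
      have hrb : r ≠ b := by omega
      simp only [hrs, hra, hrb, if_false, one_mul]
      rw [hcompl _ ⟨by omega, by omega⟩]

/-- Invert `1 + y ≤ exp y` at `y = x / (M - x)`, where `1 + y = M / (M - x)`. -/
theorem exp_le_one_sub_inv_pow {x : ℝ} (hx : 0 ≤ x) {M : ℝ} (hM : x < M) (k : ℕ) :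
    Real.exp (-(k * x / (M - x))) ≤ (1 - x / M) ^ k := by
  have hM0 : 0 < M := hx.trans_lt hM
  have hMx : 0 < M - x := sub_pos.mpr hM
  have hbase : Real.exp (-(x / (M - x))) ≤ 1 - x / M := by
    have h1 : M / (M - x) ≤ Real.exp (x / (M - x)) := by
      have := Real.add_one_le_exp (x / (M - x))
      have h2 : x / (M - x) + 1 = M / (M - x) := by field_simp; ring
      linarith
    have h3 : 1 - x / M = (M / (M - x))⁻¹ := by field_simp
    rw [Real.exp_neg, h3]
    exact inv_anti₀ (by positivity) h1
  calc Real.exp (-(k * x / (M - x))) = Real.exp (-(x / (M - x))) ^ k := by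
        rw [← Real.exp_nat_mul]; congr 1; ring
    _ ≤ _ := pow_le_pow_left₀ (Real.exp_pos _).le hbase k

theorem IsUniformDraws.measureReal_exists_isJammed_le [IsProbabilityMeasure μ]
    (hU : IsUniformDraws μ (N + 1) U)
    (hN : 14 ≤ N) {t : ℕ} (ht : N ≤ t) :
    μ.real {ω | ∃ r ≤ t, IsJammed (N + 1) (config (N + 1) (fun s => U s ω) r)} ≤
      28 * Real.exp 14 * Real.exp (t / (N - 1)) / N + ((1 - 7 / N : ℝ)⁻¹ ^ 4 - 1) := by
  have hN' : (14 : ℝ) ≤ N := by exact_mod_cast hN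
  have hq : 0 < (1 - 7 / N : ℝ) := by
    rw [sub_pos, div_lt_one (by positivity)]; linarith
  -- Disjoint windows start at multiples of `7`; the guard times are distinct and below `s = N`.
  set J : Finset (ℕ × ℕ × ℕ) := Finset.range (N / 7) ×ˢ (Finset.range N).offDiag with hJ
  set E : ℕ × ℕ × ℕ → Set Ω := fun e => freezingEvent U N t (7 * e.1) e.2.1 e.2.2 with hE
  have hmem {e : ℕ × ℕ × ℕ} (he : e ∈ J) :
      7 * e.1 + 7 ≤ N ∧ e.2.1 < N ∧ e.2.2 < N ∧ e.2.1 ≠ e.2.2 := by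
    simp only [hJ, Finset.mem_product, Finset.mem_range, Finset.mem_offDiag] at he
    obtain ⟨h1, h2, h3, h4⟩ := he
    exact ⟨by omega, h2, h3, h4⟩
  have hsum : (28 * Real.exp 14 * Real.exp (t / (N - 1)) / N)⁻¹ ≤ ∑ e ∈ J, μ.real (E e) := by
    set p : ℝ := (1 / N : ℝ) * (1 / N) * (1 - 7 / N) ^ N * (1 - 1 / N) ^ t with hp
    have h1 : J.card * p ≤ ∑ e ∈ J, μ.real (E e) := by
      rw [← nsmul_eq_mul]
      refine Finset.card_nsmul_le_sum _ _ _ fun e he => ?_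
      obtain ⟨e1, e2, e3, -⟩ := hmem he
      exact hU.le_measureReal_freezingEvent (by omega) ht e1 e2 e3
    have hcard : (N : ℝ) ^ 3 / 28 ≤ J.card := by
      have hnat : N ≤ 14 * (N / 7) := by omega
      have hr : (N : ℝ) / 14 ≤ (N / 7 : ℕ) := by
        rw [div_le_iff₀ (by norm_num)]
        have : (N : ℝ) ≤ 14 * (N / 7 : ℕ) := by exact_mod_cast hnat
        linarith
      have hJc : (J.card : ℝ) = (N / 7 : ℕ) * (N * N - N) := by
        rw [hJ, Finset.card_product, Finset.offDiag_card, Finset.card_range, Finset.card_range,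
          Nat.cast_mul, Nat.cast_sub (Nat.le_mul_self N), Nat.cast_mul]
      rw [hJc]
      calc (N : ℝ) ^ 3 / 28 = N / 14 * (N * N / 2) := by ring
        _ ≤ (N / 7 : ℕ) * (N * N - N) := by
          refine mul_le_mul hr ?_ (by positivity) (by positivity)
          nlinarith
    -- The constant comes from `7 N / (N - 7) ≤ 14` for `N ≥ 14`.
    have h7 : Real.exp (-14) ≤ (1 - 7 / N : ℝ) ^ N := by
      refine le_trans (Real.exp_le_exp.mpr ?_)
        (exp_le_one_sub_inv_pow (by norm_num) (by linarith) N)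
      rw [neg_le_neg_iff, div_le_iff₀ (by linarith)]
      linarith
    have h8 : Real.exp (-(t / (N - 1))) ≤ (1 - 1 / N : ℝ) ^ t := by
      simpa using exp_le_one_sub_inv_pow (x := 1) (M := N) (by norm_num) (by linarith) t
    refine le_trans ?_ h1
    calc (28 * Real.exp 14 * Real.exp (t / (N - 1)) / N)⁻¹
        = (N : ℝ) ^ 3 / 28 * ((1 / N : ℝ) * (1 / N) * Real.exp (-14) *
            Real.exp (-(t / (N - 1)))) := by
          rw [Real.exp_neg, Real.exp_neg]
          have := Real.exp_pos 14
          have := Real.exp_pos ((t : ℝ) / (N - 1))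
          field_simp
      _ ≤ J.card * p := by
          rw [hp]
          gcongr
  have hpos : 0 < (28 * Real.exp 14 * Real.exp (t / (N - 1)) / N)⁻¹ := by positivity
  have hmain := measureReal_forall_notMem_le (μ := μ) J (E := E)
    (fun e _ => hU.measurableSet_forall t _) (C := (1 - 7 / N : ℝ)⁻¹ ^ 4) (by positivity)
    (fun e he e' he' hne => by
      obtain ⟨e1, e2, e3, e4⟩ := hmem he
      obtain ⟨e1', e2', e3', e4'⟩ := hmem he'
      by_cases hj : e.1 = e'.1
      · have : E e ∩ E e' = ∅ := by
          rw [hE]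
          simp only [hj]
          exact disjoint_freezingEvent ht e2 e3 e4 fun h => hne (Prod.ext hj h)
        rw [this, measureReal_empty]
        positivity
      · exact hU.measureReal_freezingEvent_inter_le (by omega) ht e1 e1' (by omega) e2 e3 e2' e3')
    (hpos.trans_le hsum)
  refine (measureReal_mono ?_).trans (hmain.trans ?_)
  · rintro ω ⟨r, hr, hjam⟩ e he hω
    obtain ⟨e1, e2, e3, e4⟩ := hmem he
    exact hjam (7 * e.1 + 4) (by omega) (by omega)
      (config_eq_zero_of_freezingDraws e4 e2 e3 (by omega) hω r hr)
  · gcongr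
    exact inv_le_of_inv_le₀ (by positivity) hsum

end
-- Finiteness and two-sided estimate at scale `n log n`.
section

variable {Ω : Type*} [MeasurableSpace Ω] {μ : Measure Ω} [IsProbabilityMeasure μ]
  {N : ℕ} {U : ℕ → Ω → ℕ}

theorem numTrials_le_of_forall_drawn {n t : ℕ} {u : ℕ → ℕ}
    (h : ¬∃ i ∈ Set.Icc 1 (n - 1), ∀ r < t, u r ≠ i) : numTrials n u ≤ t := by
  push Not at h
  exact numTrials_le (isJammed_config_of_forall_drawn h)

theorem IsUniformDraws.ae_numTrials_ne_top (hU : IsUniformDraws μ (N + 1) U) (hN : 0 < N) :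
    ∀ᵐ ω ∂μ, numTrials (N + 1) (fun t => U t ω) ≠ ⊤ := by
  have hle (t : ℕ) : μ.real {ω | ¬numTrials (N + 1) (fun t => U t ω) ≠ ⊤} ≤
      N * (1 - 1 / N : ℝ) ^ t := by
    refine (measureReal_mono fun ω hω => ?_).trans (hU.measureReal_exists_not_drawn_le hN t)
    by_contra h
    exact hω (ne_top_of_le_ne_top (ENat.natCast_ne_top t) (numTrials_le_of_forall_drawn h))
  have hN' : (1 : ℝ) ≤ N := by exact_mod_cast hN
  have hlim : Tendsto (fun t : ℕ => N * (1 - 1 / N : ℝ) ^ t) atTop (𝓝 0) := by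
    have h0 : 0 < (1 / N : ℝ) := by positivity
    have h1 : (1 / N : ℝ) ≤ 1 := by rw [div_le_one (by positivity)]; exact hN'
    simpa using (tendsto_pow_atTop_nhds_zero_of_lt_one (r := (1 - 1 / N : ℝ)) (by linarith)
      (by linarith)).const_mul (N : ℝ)
  have hzero := le_antisymm (ge_of_tendsto' hlim hle) measureReal_nonneg
  rwa [measureReal_eq_zero_iff] at hzero

theorem abs_numTrials_div_sub_one_lt {n s t : ℕ} {u : ℕ → ℕ} {δ L : ℝ} (hL : 0 < L) (hδ : 0 < δ)
    (hs : s = ⌊(1 - δ) * L⌋₊) (ht : t = ⌊(1 + δ / 2) * L⌋₊)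
    (hdrawn : ¬∃ i ∈ Set.Icc 1 (n - 1), ∀ r < t, u r ≠ i)
    (hjam : ¬∃ r ≤ s, IsJammed n (config n u r)) :
    |((numTrials n u).toNat : ℝ) / L - 1| < δ := by
  have hle := numTrials_le_of_forall_drawn hdrawn
  push Not at hjam
  have hlt := lt_numTrials hjam
  -- Finiteness on this event excludes the default value `0` of `toNat` at `⊤`.
  lift numTrials n u to ℕ using ne_top_of_le_ne_top (ENat.natCast_ne_top t) hle with T
  rw [Nat.cast_le] at hle
  rw [Nat.cast_lt] at hlt
  rw [ENat.toNat_natCast]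
  have h1 : (1 - δ) * L < T := by rw [hs] at hlt; exact Nat.lt_of_floor_lt hlt
  have h2 : (T : ℝ) ≤ (1 + δ / 2) * L := by
    rw [ht] at hle
    exact (Nat.cast_le.mpr hle).trans (Nat.floor_le (by positivity))
  rw [abs_lt]
  constructor
  · have := (lt_div_iff₀ hL).mpr h1
    linarith
  · have := (div_le_iff₀ hL).mpr h2
    linarith

theorem IsUniformDraws.measureReal_le_abs_numTrials_div_sub_one_le
    (hU : IsUniformDraws μ (N + 1) U) {δ : ℝ} (hδ : 0 < δ) (hδ' : δ ≤ 1 / 2) (hN : 14 ≤ N)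
    (hNδ : 4 / δ ≤ N) (hNlog : 2 ≤ Real.log (N + 1)) :
    μ.real {ω | δ ≤ |((numTrials (N + 1) (fun t => U t ω)).toNat : ℝ) /
        ((N + 1) * Real.log (N + 1)) - 1|} ≤
      (Real.exp 1 + 56 * Real.exp 14) * Real.exp (-(δ / 2 * Real.log (N + 1))) +
        ((1 - 7 / N : ℝ)⁻¹ ^ 4 - 1) := by
  have hN' : (14 : ℝ) ≤ N := by exact_mod_cast hN
  set l := Real.log (N + 1) with hl
  have hexpl : Real.exp l = N + 1 := Real.exp_log (by positivity)
  set s := ⌊(1 - δ) * ((N + 1) * l)⌋₊ with hs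
  set t := ⌊(1 + δ / 2) * ((N + 1) * l)⌋₊ with ht
  -- The guards need the first `N` trials; `δ ≤ 1/2` and `l ≥ 2` leave room for them.
  have hsN : N ≤ s := by
    refine Nat.le_floor ?_
    have : (N + 1 : ℝ) * 2 ≤ (N + 1) * l := by gcongr
    nlinarith
  have hs_le : (s : ℝ) ≤ (1 - δ) * ((N + 1) * l) :=
    Nat.floor_le (mul_nonneg (by linarith) (by positivity))
  have ht_le : (1 + δ / 2) * ((N + 1) * l) < t + 1 := Nat.lt_floor_add_one _
  have hupper : (N : ℝ) * (1 - 1 / N) ^ t ≤ Real.exp 1 * Real.exp (-(δ / 2 * l)) := by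
    have hbase : 0 ≤ (1 - 1 / N : ℝ) := by
      rw [sub_nonneg, div_le_one (by positivity)]
      linarith
    have h1 : (1 - 1 / N : ℝ) ^ t ≤ Real.exp (1 - (1 + δ / 2) * l) := by
      calc (1 - 1 / N : ℝ) ^ t ≤ Real.exp (-(1 / N)) ^ t := by
            exact pow_le_pow_left₀ hbase (Real.one_sub_le_exp_neg _) t
        _ = Real.exp (-(t / N)) := by rw [← Real.exp_nat_mul]; congr 1; ring
        _ ≤ Real.exp (1 - (1 + δ / 2) * l) := by
          rw [Real.exp_le_exp]
          have h2 : ((1 + δ / 2) * l - 1) ≤ t / N := by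
            rw [le_div_iff₀ (by positivity)]
            have : 0 ≤ (1 + δ / 2) * l := by positivity
            nlinarith
          linarith
    calc (N : ℝ) * (1 - 1 / N) ^ t ≤ Real.exp l * Real.exp (1 - (1 + δ / 2) * l) := by
          rw [hexpl]
          exact mul_le_mul (by linarith) h1 (pow_nonneg hbase t) (by positivity)
      _ = _ := by rw [← Real.exp_add, ← Real.exp_add]; congr 1; ring
  have hlower : 28 * Real.exp 14 * Real.exp (s / (N - 1)) / N ≤
      56 * Real.exp 14 * Real.exp (-(δ / 2 * l)) := by
    have h1 : (s : ℝ) / (N - 1) ≤ (1 - δ / 2) * l := by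
      rw [div_le_iff₀ (by linarith)]
      -- Half of `δ` pays for replacing `N + 1` by `N - 1`; this is where `4 / δ ≤ N` enters.
      have h2 : (1 - δ) * (N + 1) ≤ (1 - δ / 2) * (N - 1 : ℝ) := by
        rw [div_le_iff₀ hδ] at hNδ
        nlinarith
      have h3 := mul_le_mul_of_nonneg_right h2 (by linarith : 0 ≤ l)
      linarith
    have h2 : Real.exp (s / (N - 1)) ≤ 2 * N * Real.exp (-(δ / 2 * l)) := by
      calc Real.exp (s / (N - 1)) ≤ Real.exp (l + -(δ / 2 * l)) := by
            rw [Real.exp_le_exp]; linarith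
        _ = (N + 1) * Real.exp (-(δ / 2 * l)) := by rw [Real.exp_add, hexpl]
        _ ≤ _ := by gcongr; linarith
    rw [div_le_iff₀ (by positivity)]
    calc 28 * Real.exp 14 * Real.exp (s / (N - 1))
        ≤ 28 * Real.exp 14 * (2 * N * Real.exp (-(δ / 2 * l))) := by gcongr
      _ = _ := by ring
  have hA := hU.measureReal_exists_not_drawn_le (by omega) t
  have hB := hU.measureReal_exists_isJammed_le hN hsN
  have hsub : {ω | δ ≤ |((numTrials (N + 1) (fun t => U t ω)).toNat : ℝ) / ((N + 1) * l) - 1|} ⊆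
      {ω | ∃ i ∈ Set.Icc 1 N, ∀ r < t, U r ω ≠ i} ∪
        {ω | ∃ r ≤ s, IsJammed (N + 1) (config (N + 1) (fun s => U s ω) r)} := by
    intro ω hω
    by_contra h
    rw [Set.mem_union, not_or] at h
    exact absurd hω (not_le.mpr
      (abs_numTrials_div_sub_one_lt (n := N + 1) (u := fun t => U t ω)
        (by positivity) hδ hs ht h.1 h.2))
  have := (measureReal_mono (μ := μ) hsub).trans (measureReal_union_le _ _)
  linarith

end

/-! ### Passage to the limit. -/

theorem tendsto_numTrials_bound {δ : ℝ} (hδ : 0 < δ) :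
    Tendsto (fun N : ℕ => (Real.exp 1 + 56 * Real.exp 14) *
      Real.exp (-(δ / 2 * Real.log (N + 1))) + ((1 - 7 / N : ℝ)⁻¹ ^ 4 - 1)) atTop (𝓝 0) := by
  have h1 : Tendsto (fun N : ℕ => Real.exp (-(δ / 2 * Real.log (N + 1)))) atTop (𝓝 0) := by
    have : Tendsto (fun N : ℕ => (N + 1 : ℝ)) atTop atTop :=
      tendsto_atTop_add_const_right _ _ tendsto_natCast_atTop_atTop
    exact Real.tendsto_exp_neg_atTop_nhds_zero.comp
      ((Real.tendsto_log_atTop.comp this).const_mul_atTop (by positivity))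
  have h2 : Tendsto (fun N : ℕ => (1 - 7 / N : ℝ)⁻¹ ^ 4 - 1) atTop (𝓝 ((1 - 0)⁻¹ ^ 4 - 1)) :=
    ((((tendsto_const_div_atTop_nhds_zero_nat (7 : ℝ)).const_sub 1).inv₀ (by norm_num)).pow 4
      ).sub_const 1
  simpa using (h1.const_mul (Real.exp 1 + 56 * Real.exp 14)).add h2

end PageParking

theorem mainTheorem4 {Ω : ℕ → Type*} [∀ n, MeasurableSpace (Ω n)]
    (μ : ∀ n, Measure (Ω n)) [∀ n, IsProbabilityMeasure (μ n)]
    (U : ∀ n, ℕ → Ω n → ℕ)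
    (hU : ∀ n, 2 ≤ n → PageParking.IsUniformDraws (μ n) n (U n)) :
    (∀ n, 2 ≤ n → ∀ᵐ ω ∂(μ n), PageParking.numTrials n (fun t => U n t ω) ≠ ⊤) ∧
    ∀ ε : ℝ, 0 < ε →
      Tendsto
        (fun n : ℕ => μ n {ω |
          ε ≤ |((PageParking.numTrials n (fun t => U n t ω)).toNat : ℝ) / (n * Real.log n) - 1|})
        atTop (𝓝 0) := by
  constructor
  · intro n hn
    obtain ⟨N, rfl⟩ : ∃ N, n = N + 1 := ⟨n - 1, by omega⟩
    exact (hU _ hn).ae_numTrials_ne_top (by omega)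
  · intro ε hε
    -- Shrinking `ε` only enlarges the deviation event, and the estimate needs `δ ≤ 1/2`.
    set δ := min ε (1 / 2) with hδdef
    have hδ : 0 < δ := lt_min hε (by norm_num)
    rw [← tendsto_add_atTop_iff_nat 1]
    have hbound := ENNReal.tendsto_ofReal (PageParking.tendsto_numTrials_bound hδ)
    rw [ENNReal.ofReal_zero] at hbound
    refine tendsto_of_tendsto_of_tendsto_of_le_of_le' tendsto_const_nhds hbound
      (Eventually.of_forall fun _ => zero_le) ?_
    have hlog : Tendsto (fun N : ℕ => Real.log (N + 1 : ℝ)) atTop atTop :=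
      Real.tendsto_log_atTop.comp
        (tendsto_atTop_add_const_right _ _ tendsto_natCast_atTop_atTop)
    filter_upwards [eventually_ge_atTop 14, hlog.eventually_ge_atTop 2,
      tendsto_natCast_atTop_atTop.eventually_ge_atTop (4 / δ)] with N hN hNlog hNδ
    have h := (hU (N + 1) (by omega)).measureReal_le_abs_numTrials_div_sub_one_le hδ
      (min_le_right _ _) hN hNδ hNlog
    refine (measure_mono fun ω hω => ?_).trans
      (ENNReal.le_ofReal_iff_toReal_le (measure_ne_top _ _) (measureReal_nonneg.trans h) |>.mpr h)
    simp only [Set.mem_ofPred_eq, Nat.cast_add, Nat.cast_one] at hω ⊢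
    exact (min_le_left _ _).trans hω
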